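/- A topological space $X$ is \emph{functionally countable} if every continuous function $f\colon X\to\mathbb{R}$ has countable image, and \emph{pseudocompact} if it is Tychonoff (completely regular and Hausdorff) and every continuous function $f\colon X\to\mathbb{R}$ is bounded. Let $I$ be a finite set and let $(X_i)_{i\in I}$ be a family of topological spaces each of which is pseudocompact and functionally countable. Then the product $\prod_{i\in I}X_i$, with the product topology, is pseudocompact and functionally countable. -/

import Mathlib

/-- A space is functionally countable if every continuous real-valued function on it has
countable image. -/
def FunctionallyCountable (X : Type*) [TopologicalSpace X] : Prop :=
  ∀ f : X → ℝ, Continuous f → (Set.range f).Countable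

/-- A space is pseudocompact if it is Tychonoff (completely regular and T₀, hence Hausdorff)
and every continuous real-valued function on it is bounded. -/
def Pseudocompact (X : Type*) [TopologicalSpace X] : Prop :=
  T35Space X ∧ ∀ f : X → ℝ, Continuous f → ∃ C : ℝ, ∀ x, |f x| ≤ C

/-!
Call a space *densely sequentially compact* if it has a dense subset `D` such that every sequence
in `D` has a subsequence converging in the space. This property passes to finite products and
forces continuous real functions to be bounded, so the proof consists in relating it to the two
properties of the theorem.

* A pseudocompact functionally countable `X` is densely sequentially compact
  (`Pseudocompact.denselySeqCompact`). A continuous function on `StoneCech X` takes no values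
  outside its image of `X`, so `StoneCech X` is functionally countable. A compact Hausdorff
  functionally countable space is scattered: otherwise a closed subset without isolated points
  would map onto the Cantor space. Hence sequences in `StoneCech X` have convergent subsequences
  and its isolated points, which all lie in `X`, are dense. A sequence of isolated points which
  converges to a point outside `X` would enumerate an infinite closed set of isolated points of
  `X`, and `X` would carry an unbounded continuous function.

* If `X` and `Y` are densely sequentially compact and `f : X × Y → ℝ` is continuous, then
  `y ↦ f (·, y)` is continuous for the sup norm (`DenselySeqCompact.eventually_forall_abs_sub_le`).
  Its range is then a compact metric space, and it is countable when `Y` is functionally countable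
  (`FunctionallyCountable.countable_range`). Each section `f (·, y)` has countable range when `X`
  is functionally countable, so `f` itself has countable range.
-/

open Set Filter Topology

/-! ### Functional countability -/

theorem FunctionallyCountable.of_surjective {X Y : Type*} [TopologicalSpace X]
    [TopologicalSpace Y] (hX : FunctionallyCountable X) {p : X → Y} (hp : Continuous p)
    (hs : Function.Surjective p) : FunctionallyCountable Y := by
  intro f hf
  rw [← hs.range_comp f]
  exact hX _ (hf.comp hp)

theorem FunctionallyCountable.of_isClosedEmbedding {X Y : Type*} [TopologicalSpace X]
    [TopologicalSpace Y] [NormalSpace Y] (hY : FunctionallyCountable Y) {e : X → Y}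
    (he : IsClosedEmbedding e) : FunctionallyCountable X := by
  intro f hf
  obtain ⟨g, hg⟩ := ContinuousMap.exists_extension he ⟨f, hf⟩
  refine (hY g g.continuous).mono ?_
  rintro _ ⟨x, rfl⟩
  exact ⟨e x, DFunLike.congr_fun hg x⟩

theorem not_functionallyCountable_cantorSpace : ¬ FunctionallyCountable (ℕ → Bool) := by
  intro h
  have hc := h (fun s => (cantorSetHomeomorphNatToBool.symm s : ℝ))
    (continuous_subtype_val.comp cantorSetHomeomorphNatToBool.symm.continuous)
  have hinj : Function.Injective fun s : ℕ → Bool =>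
      (cantorSetHomeomorphNatToBool.symm s : ℝ) :=
    Subtype.val_injective.comp cantorSetHomeomorphNatToBool.symm.injective
  have : Countable (ℕ → Bool) := by
    have := hc.to_subtype
    exact (rangeFactorization_injective.2 hinj).countable
  obtain ⟨e, he⟩ := exists_surjective_nat (ℕ → Bool)
  obtain ⟨n, hn⟩ := he fun k => !e k k
  have := congr_fun hn n
  simp at this

/-- In a functionally countable normal Hausdorff space, clopen sets separate points: a Urysohn
function omits some value strictly between `0` and `1`. -/
theorem FunctionallyCountable.exists_clopens_separating {X : Type*} [TopologicalSpace X]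
    [NormalSpace X] [T1Space X] (hX : FunctionallyCountable X) {x y : X} (hxy : x ≠ y) :
    ∃ U : TopologicalSpace.Clopens X, x ∈ U ∧ y ∉ U := by
  obtain ⟨f, hf0, hf1, -⟩ := exists_continuous_zero_one_of_isClosed (isClosed_singleton (x := x))
    (isClosed_singleton (x := y)) (by simpa using hxy)
  have h0 : f x = 0 := hf0 rfl
  have h1 : f y = 1 := hf1 rfl
  obtain ⟨r, hr, hr01⟩ := ((hX f f.continuous).dense_compl ℝ).exists_between
    (zero_lt_one (α := ℝ))
  have heq : {z | f z < r} = {z | f z ≤ r} := by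
    ext z
    exact ⟨fun (h : f z < r) => h.le, fun h => lt_of_le_of_ne h fun h' => hr ⟨z, h'⟩⟩
  refine ⟨⟨{z | f z < r}, ?_, isOpen_lt f.continuous continuous_const⟩, ?_, ?_⟩
  · rw [heq]
    exact isClosed_le f.continuous continuous_const
  · change f x < r
    rw [h0]
    exact hr01.1
  · change ¬ f y < r
    rw [h1]
    exact hr01.2.le.not_gt

/-! ### Compact functionally countable spaces are scattered -/

section CantorAddress

variable {X : Type*} [TopologicalSpace X]

open TopologicalSpace Classical in
/-- The piece of depth `n` containing `x` in the dyadic tree of clopen sets that starts with the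
whole space and cuts each piece `U` into `U ⊓ φ U` and `U \ φ U`. -/
noncomputable def clopenPiece (φ : Clopens X → Clopens X) (x : X) : ℕ → Clopens X
  | 0 => ⊤
  | n + 1 => if x ∈ φ (clopenPiece φ x n) then clopenPiece φ x n ⊓ φ (clopenPiece φ x n)
      else clopenPiece φ x n \ φ (clopenPiece φ x n)

open TopologicalSpace in
/-- The node of depth `n` on the branch `s` of the dyadic tree of clopen sets cut out by `φ`. -/
def clopenBranch (φ : Clopens X → Clopens X) (s : ℕ → Bool) : ℕ → Clopens X
  | 0 => ⊤
  | n + 1 => bif s n then clopenBranch φ s n ⊓ φ (clopenBranch φ s n)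
      else clopenBranch φ s n \ φ (clopenBranch φ s n)

open TopologicalSpace Classical in
/-- The branch followed by the pieces that contain `x`. -/
noncomputable def clopenAddress (φ : Clopens X → Clopens X) (x : X) (n : ℕ) : Bool :=
  decide (x ∈ φ (clopenPiece φ x n))

theorem eventually_mem_clopens_iff (U : TopologicalSpace.Clopens X) (x : X) :
    ∀ᶠ y in 𝓝 x, (y ∈ U ↔ x ∈ U) := by
  by_cases hx : x ∈ U
  · filter_upwards [U.isClopen.isOpen.mem_nhds hx] with y hy
    exact iff_of_true hy hx
  · filter_upwards [U.isClopen.compl.isOpen.mem_nhds hx] with y hy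
    exact iff_of_false hy hx

open TopologicalSpace in
theorem eventually_clopenPiece_eq (φ : Clopens X → Clopens X) (x : X) (n : ℕ) :
    ∀ᶠ y in 𝓝 x, clopenPiece φ y n = clopenPiece φ x n := by
  induction n with
  | zero => exact Eventually.of_forall fun _ => rfl
  | succ n ih =>
    have hmem := eventually_mem_clopens_iff (φ (clopenPiece φ x n)) x
    filter_upwards [ih, hmem] with y hy hy'
    rw [clopenPiece, clopenPiece, hy]
    classical exact if_congr hy' rfl rfl

open TopologicalSpace in
theorem continuous_clopenAddress (φ : Clopens X → Clopens X) : Continuous (clopenAddress φ) := by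
  refine continuous_pi fun n => ((IsLocallyConstant.iff_eventually_eq _).2 fun x => ?_).continuous
  have hmem := eventually_mem_clopens_iff (φ (clopenPiece φ x n)) x
  filter_upwards [eventually_clopenPiece_eq φ x n, hmem] with y h1 h2
  rw [clopenAddress, clopenAddress, h1]
  exact decide_eq_decide.2 h2

open TopologicalSpace in
/-- A branch whose nodes are all nonempty has, by compactness, a common point, and that point has
the given branch as its address. -/
theorem surjective_clopenAddress [CompactSpace X] [Nonempty X] {φ : Clopens X → Clopens X}
    (h1 : ∀ U : Clopens X, (U : Set X).Nonempty → ((U ⊓ φ U : Clopens X) : Set X).Nonempty)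
    (h2 : ∀ U : Clopens X, (U : Set X).Nonempty → ((U \ φ U : Clopens X) : Set X).Nonempty) :
    Function.Surjective (clopenAddress φ) := by
  intro s
  have hne : ∀ n, (clopenBranch φ s n : Set X).Nonempty := by
    intro n
    induction n with
    | zero => exact univ_nonempty
    | succ n ih =>
      rw [clopenBranch]
      cases s n
      · exact h2 _ ih
      · exact h1 _ ih
  have hanti : ∀ n, (clopenBranch φ s (n + 1) : Set X) ⊆ clopenBranch φ s n := by
    intro n
    rw [clopenBranch]
    cases s n
    · exact fun x hx => hx.1
    · exact fun x hx => hx.1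
  obtain ⟨x, hx⟩ := IsCompact.nonempty_iInter_of_sequence_nonempty_isCompact_isClosed
    (fun n => (clopenBranch φ s n : Set X)) hanti hne
    (clopenBranch φ s 0).isClopen.isClosed.isCompact
    (fun n => (clopenBranch φ s n).isClopen.isClosed)
  rw [mem_iInter] at hx
  have hmem : ∀ n, (x ∈ φ (clopenBranch φ s n) ↔ s n = true) := by
    intro n
    have := hx (n + 1)
    rw [clopenBranch] at this
    cases hs : s n
    · rw [hs] at this
      exact iff_of_false this.2 (by simp)
    · rw [hs] at this
      exact iff_of_true this.2 rfl
  have hpiece : ∀ n, clopenPiece φ x n = clopenBranch φ s n := by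
    intro n
    induction n with
    | zero => rfl
    | succ n ih =>
      rw [clopenPiece, clopenBranch, ih]
      cases hs : s n
      · rw [if_neg (by simp [hmem, hs])]
        rfl
      · rw [if_pos (by simp [hmem, hs])]
        rfl
  refine ⟨x, funext fun n => ?_⟩
  rw [clopenAddress, hpiece]
  cases hs : s n <;> simp [hmem, hs]

end CantorAddress

/-- If there were no isolated point, every nonempty clopen set could be cut into two nonempty
clopen pieces, and iterating this would map the space onto the Cantor space. -/
theorem FunctionallyCountable.exists_isOpen_singleton {X : Type*} [TopologicalSpace X]
    [CompactSpace X] [T2Space X] [Nonempty X] (hX : FunctionallyCountable X) :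
    ∃ x : X, IsOpen {x} := by
  by_contra! hno
  have hsplit : ∀ U : TopologicalSpace.Clopens X, ∃ V : TopologicalSpace.Clopens X,
      (U : Set X).Nonempty → ((U ⊓ V : TopologicalSpace.Clopens X) : Set X).Nonempty ∧
        ((U \ V : TopologicalSpace.Clopens X) : Set X).Nonempty := by
    intro U
    by_cases hU : (U : Set X).Nonempty
    · obtain ⟨x, hx⟩ := hU
      have : ∃ y ∈ (U : Set X), y ≠ x := by
        by_contra! h
        refine hno x ?_
        rw [← Set.eq_singleton_iff_unique_mem.2 ⟨hx, h⟩]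
        exact U.isClopen.isOpen
      obtain ⟨y, hy, hyx⟩ := this
      obtain ⟨V, hxV, hyV⟩ := hX.exists_clopens_separating hyx.symm
      exact ⟨V, fun _ => ⟨⟨x, hx, hxV⟩, ⟨y, hy, hyV⟩⟩⟩
    · exact ⟨⊤, fun h => absurd h hU⟩
  choose φ hφ using hsplit
  exact not_functionallyCountable_cantorSpace (hX.of_surjective (continuous_clopenAddress φ)
    (surjective_clopenAddress (fun U hU => (hφ U hU).1) fun U hU => (hφ U hU).2))

theorem FunctionallyCountable.exists_isOpen_inter_eq_singleton {X : Type*} [TopologicalSpace X]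
    [CompactSpace X] [T2Space X] (hX : FunctionallyCountable X) {C : Set X} (hC : IsClosed C)
    (hne : C.Nonempty) : ∃ x, ∃ O : Set X, IsOpen O ∧ O ∩ C = {x} := by
  have := hne.to_subtype
  have := isCompact_iff_compactSpace.1 hC.isCompact
  obtain ⟨x, hx⟩ :=
    (hX.of_isClosedEmbedding hC.isClosedEmbedding_subtypeVal).exists_isOpen_singleton
  obtain ⟨O, hO, hOx⟩ := isOpen_induced_iff.1 hx
  refine ⟨x, O, hO, ?_⟩
  rw [inter_comm, ← Subtype.image_preimage_coe, hOx, image_singleton]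

theorem FunctionallyCountable.dense_isolated {X : Type*} [TopologicalSpace X]
    [CompactSpace X] [T2Space X] (hX : FunctionallyCountable X) : Dense {x : X | IsOpen {x}} := by
  refine dense_iff_inter_open.2 fun U hU ⟨a, ha⟩ => ?_
  obtain ⟨t, hta, htc, htU⟩ := exists_mem_nhds_isClosed_subset (hU.mem_nhds ha)
  have ha' : a ∈ interior t := mem_interior_iff_mem_nhds.2 hta
  obtain ⟨x, O, hO, hOx⟩ := hX.exists_isOpen_inter_eq_singleton
    (isClosed_closure (s := interior t)) ⟨a, subset_closure ha'⟩
  have hx : x ∈ O ∩ closure (interior t) := by rw [hOx]; rfl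
  -- `x` lies in the closure of the open set `interior t`, so its neighbourhood `O` meets that set.
  obtain ⟨z, hzO, hzt⟩ := mem_closure_iff.1 hx.2 O hO hx.1
  have hsub : O ∩ interior t ⊆ {x} := by
    rw [← hOx]
    exact inter_subset_inter_right _ subset_closure
  obtain rfl : z = x := hsub ⟨hzO, hzt⟩
  refine ⟨z, htU (interior_subset hzt), ?_⟩
  have : O ∩ interior t = {z} := hsub.antisymm (singleton_subset_iff.2 ⟨hzO, hzt⟩)
  change IsOpen {z}
  rw [← this]
  exact hO.inter isOpen_interior

/-- The set of cluster points of a sequence is closed and has an isolated point `p`. The terms that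
lie in a closed neighbourhood of `p` containing no other cluster point converge to `p`. -/
theorem FunctionallyCountable.exists_tendsto_subseq {X : Type*} [TopologicalSpace X]
    [CompactSpace X] [T2Space X] (hX : FunctionallyCountable X) (u : ℕ → X) :
    ∃ p, ∃ φ : ℕ → ℕ, StrictMono φ ∧ Tendsto (u ∘ φ) atTop (𝓝 p) := by
  have hcl : IsClosed {x | MapClusterPt x atTop u} := isClosed_setOfPred_clusterPt
  obtain ⟨c, -, hc⟩ := isCompact_univ.exists_mapClusterPt (f := atTop) (u := u) (by simp)
  obtain ⟨p, O, hO, hOp⟩ := hX.exists_isOpen_inter_eq_singleton hcl ⟨c, hc⟩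
  have hp : p ∈ O ∩ {x | MapClusterPt x atTop u} := by rw [hOp]; rfl
  obtain ⟨t, htp, htc, htO⟩ := exists_mem_nhds_isClosed_subset (hO.mem_nhds hp.1)
  obtain ⟨φ, hφ, hφt⟩ := extraction_of_frequently_atTop (hp.2.frequently htp)
  refine ⟨p, φ, hφ, htc.isCompact.tendsto_nhds_of_unique_mapClusterPt
    (Eventually.of_forall hφt) fun y hy hyc => ?_⟩
  have : y ∈ O ∩ {x | MapClusterPt x atTop u} := ⟨htO hy, hyc.of_comp hφ.tendsto_atTop⟩
  rw [hOp] at this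
  exact this

/-! ### Dense sequential compactness -/

/-- Some dense set `D` has the property that each sequence in `D` has a subsequence converging to a
point of the space, which need not be in `D`. -/
def DenselySeqCompact (X : Type*) [TopologicalSpace X] : Prop :=
  ∃ D : Set X, Dense D ∧ ∀ u : ℕ → X, (∀ n, u n ∈ D) →
    ∃ a, ∃ φ : ℕ → ℕ, StrictMono φ ∧ Tendsto (u ∘ φ) atTop (𝓝 a)

theorem DenselySeqCompact.of_surjective {X Y : Type*} [TopologicalSpace X]
    [TopologicalSpace Y] (hX : DenselySeqCompact X) {p : X → Y} (hp : Continuous p)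
    (hs : Function.Surjective p) : DenselySeqCompact Y := by
  obtain ⟨D, hD, h⟩ := hX
  refine ⟨p '' D, hs.denseRange.dense_image hp hD, fun u hu => ?_⟩
  choose v hv hvu using hu
  obtain ⟨a, φ, hφ, ha⟩ := h v hv
  refine ⟨p a, φ, hφ, ?_⟩
  have : u ∘ φ = p ∘ (v ∘ φ) := funext fun n => (hvu _).symm
  rw [this]
  exact (hp.tendsto a).comp ha

theorem DenselySeqCompact.prod {X Y : Type*} [TopologicalSpace X] [TopologicalSpace Y]
    (hX : DenselySeqCompact X) (hY : DenselySeqCompact Y) : DenselySeqCompact (X × Y) := by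
  obtain ⟨D, hD, h⟩ := hX
  obtain ⟨E, hE, k⟩ := hY
  refine ⟨D ×ˢ E, hD.prod hE, fun u hu => ?_⟩
  obtain ⟨a, φ, hφ, ha⟩ := h (fun n => (u n).1) fun n => (hu n).1
  obtain ⟨b, ψ, hψ, hb⟩ := k (fun n => (u (φ n)).2) fun n => (hu _).2
  exact ⟨(a, b), φ ∘ ψ, hφ.comp hψ, (ha.comp hψ.tendsto_atTop).prodMk_nhds hb⟩

theorem DenselySeqCompact.isCompact_range {X M : Type*} [TopologicalSpace X] [MetricSpace M]
    (hX : DenselySeqCompact X) {F : X → M} (hF : Continuous F) : IsCompact (range F) := by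
  obtain ⟨D, hD, h⟩ := hX
  refine IsSeqCompact.isCompact fun v hv => ?_
  have happ : ∀ n : ℕ, ∃ d ∈ D, dist (F d) (v n) < 1 / ((n : ℝ) + 1) := by
    intro n
    obtain ⟨x, hx⟩ := hv n
    obtain ⟨d, hdU, hdD⟩ := hD.inter_open_nonempty {d | dist (F d) (v n) < 1 / ((n : ℝ) + 1)}
      (isOpen_lt (hF.dist continuous_const) continuous_const)
      ⟨x, by simp only [mem_ofPred_eq, hx, dist_self]; positivity⟩
    exact ⟨d, hdD, hdU⟩
  choose d hdD hd using happ
  obtain ⟨a, φ, hφ, ha⟩ := h d hdD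
  refine ⟨F a, mem_range_self a, φ, hφ, ?_⟩
  refine tendsto_of_tendsto_of_dist ((hF.tendsto a).comp ha) ?_
  refine squeeze_zero (fun _ => dist_nonneg) (fun n => (hd (φ n)).le)
    (tendsto_one_div_add_atTop_nhds_zero_nat.comp hφ.tendsto_atTop)

theorem DenselySeqCompact.exists_forall_abs_le {X : Type*} [TopologicalSpace X]
    (hX : DenselySeqCompact X) {f : X → ℝ} (hf : Continuous f) : ∃ C : ℝ, ∀ x, |f x| ≤ C := by
  obtain ⟨C, hC⟩ := (hX.isCompact_range hf).isBounded.exists_norm_le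
  exact ⟨C, fun x => hC _ (mem_range_self x)⟩

/-- The range is a compact metric space. If it were uncountable it would contain a closed copy of
the Cantor space, hence, by Tietze extension, it would not be functionally countable. -/
theorem FunctionallyCountable.countable_range {X M : Type*} [TopologicalSpace X] [MetricSpace M]
    (hX : FunctionallyCountable X) (hX' : DenselySeqCompact X) {F : X → M} (hF : Continuous F) :
    (range F).Countable := by
  have := isCompact_iff_compactSpace.1 (hX'.isCompact_range hF)
  have hfc : FunctionallyCountable (range F) :=
    hX.of_surjective hF.rangeFactorization rangeFactorization_surjective
  by_contra hunc
  obtain ⟨g, -, hg, hginj⟩ :=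
    (isClosed_univ (X := range F)).exists_nat_bool_injection_of_not_countable
      (by rwa [countable_univ_iff])
  exact not_functionallyCountable_cantorSpace
    (hfc.of_isClosedEmbedding (hg.isClosedEmbedding hginj))

/-! ### The isolated points of the Stone–Čech compactification -/

/-- If a continuous function on `StoneCech X` took a value `t` outside its image of `X`, the
reciprocal of its distance to `t` would be unbounded on `X`. -/
theorem Pseudocompact.range_comp_stoneCechUnit {X : Type*} [TopologicalSpace X]
    (hX : Pseudocompact X) {g : StoneCech X → ℝ} (hg : Continuous g) :
    range (g ∘ stoneCechUnit) = range g := by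
  refine (range_comp_subset_range _ _).antisymm ?_
  rintro _ ⟨k, rfl⟩
  by_contra hk
  have hne : ∀ x : X, |g (stoneCechUnit x) - g k| ≠ 0 := fun x h =>
    hk ⟨x, sub_eq_zero.1 (abs_eq_zero.1 h)⟩
  have hcont : Continuous fun x : X => |g (stoneCechUnit x) - g k| :=
    ((hg.comp continuous_stoneCechUnit).sub continuous_const).abs
  obtain ⟨C, hC⟩ := hX.2 _ (hcont.inv₀ hne)
  have hC1 : 0 < |C| + 1 := by positivity
  obtain ⟨x, hx⟩ := denseRange_stoneCechUnit.exists_mem_open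
    (s := {z | |g z - g k| < (|C| + 1)⁻¹})
    (isOpen_lt (hg.sub continuous_const).abs continuous_const)
    ⟨k, by simpa using hC1⟩
  have h1 : |C| + 1 < |g (stoneCechUnit x) - g k|⁻¹ :=
    (lt_inv_comm₀ hC1 (lt_of_le_of_ne (abs_nonneg _) (hne x).symm)).2 hx
  have h2 : |g (stoneCechUnit x) - g k|⁻¹ ≤ C := (le_abs_self _).trans (hC x)
  linarith [le_abs_self C]

theorem Pseudocompact.functionallyCountable_stoneCech {X : Type*} [TopologicalSpace X]
    (hX : Pseudocompact X) (hX' : FunctionallyCountable X) :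
    FunctionallyCountable (StoneCech X) := by
  intro g hg
  rw [← hX.range_comp_stoneCechUnit hg]
  exact hX' _ (hg.comp continuous_stoneCechUnit)

/-- A closed set all of whose points are isolated in the whole space is finite, since any function
on it extends by zero to a continuous one. -/
theorem Pseudocompact.finite_of_isClosed_of_isolated {X : Type*} [TopologicalSpace X]
    (hX : Pseudocompact X) {A : Set X} (hA : IsClosed A) (hiso : ∀ x ∈ A, IsOpen {x}) :
    A.Finite := by
  by_contra hinf
  let i := Set.Infinite.natEmbedding A hinf
  have hi : Function.Injective fun n => (i n : X) := Subtype.val_injective.comp i.injective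
  let g : X → ℝ := Function.extend (fun n => (i n : X)) (fun n => (n : ℝ)) 0
  have hg : Continuous g := by
    refine continuous_iff_continuousAt.2 fun x => ?_
    by_cases hx : x ∈ A
    · have : 𝓝 x = pure x := (isOpen_singleton_iff_nhds_eq_pure x).1 (hiso x hx)
      rw [ContinuousAt, this]
      exact tendsto_pure_nhds g x
    · have hz : ∀ y ∉ A, g y = 0 := fun y hy =>
        Function.extend_apply' _ _ _ fun ⟨n, hn⟩ => hy (hn ▸ (i n).2)
      refine (continuousAt_const (y := (0 : ℝ))).congr ?_
      filter_upwards [hA.isOpen_compl.mem_nhds hx] with y hy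
      exact (hz y hy).symm
  obtain ⟨C, hC⟩ := hX.2 g hg
  obtain ⟨n, hn⟩ := exists_nat_gt C
  have := hC (i n)
  rw [show g (i n) = n from hi.extend_apply _ _ n] at this
  linarith [le_abs_self (n : ℝ)]

theorem Pseudocompact.denselySeqCompact {X : Type*} [TopologicalSpace X]
    (hX : Pseudocompact X) (hX' : FunctionallyCountable X) : DenselySeqCompact X := by
  have := hX.1
  have hK := hX.functionallyCountable_stoneCech hX'
  have hemb : IsEmbedding (stoneCechUnit : X → StoneCech X) := isEmbedding_stoneCechUnit
  refine ⟨{x | IsOpen {stoneCechUnit x}}, ?_, fun u hu => ?_⟩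
  · refine dense_iff_inter_open.2 fun U hU ⟨a, ha⟩ => ?_
    obtain ⟨O, hO, rfl⟩ := hemb.isOpen_iff.1 hU
    obtain ⟨k, hkO, hk⟩ := hK.dense_isolated.inter_open_nonempty O hO ⟨_, ha⟩
    obtain ⟨x, hx⟩ := denseRange_stoneCechUnit.exists_mem_open hk ⟨k, rfl⟩
    obtain rfl : stoneCechUnit x = k := hx
    exact ⟨x, hkO, hk⟩
  · obtain ⟨p, φ, hφ, hp⟩ := hK.exists_tendsto_subseq (stoneCechUnit ∘ u)
    by_cases hpX : p ∈ range (stoneCechUnit : X → StoneCech X)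
    · obtain ⟨x, rfl⟩ := hpX
      exact ⟨x, φ, hφ, hemb.tendsto_nhds_iff.2 hp⟩
    · exfalso
      have hpre : stoneCechUnit ⁻¹' (insert p (range (stoneCechUnit ∘ u ∘ φ))) =
          range (u ∘ φ) := by
        ext x
        constructor
        · rintro (h | ⟨n, hn⟩)
          · exact absurd ⟨x, h⟩ hpX
          · exact ⟨n, hemb.injective hn⟩
        · rintro ⟨n, rfl⟩
          exact Or.inr ⟨n, rfl⟩
      have hcl : IsClosed (range (u ∘ φ)) := by
        rw [← hpre]
        exact (hp.isCompact_insert_range).isClosed.preimage continuous_stoneCechUnit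
      have hfin : (range (u ∘ φ)).Finite := by
        refine hX.finite_of_isClosed_of_isolated hcl ?_
        rintro _ ⟨n, rfl⟩
        rw [← hemb.injective.preimage_image {(u ∘ φ) n}, image_singleton]
        exact (hu (φ n)).preimage continuous_stoneCechUnit
      have hmem : p ∈ stoneCechUnit '' range (u ∘ φ) :=
        (hfin.image _).isClosed.mem_of_tendsto hp
          (Eventually.of_forall fun n => ⟨_, ⟨n, rfl⟩, rfl⟩)
      exact hpX (image_subset_range _ _ hmem)

/-! ### Products -/

/-- Otherwise there are points `(aₙ, bₙ)` with `|f (aₙ, bₙ) - f (aₙ, y₀)| > ε` and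
`|f (aₙ, bₘ) - f (aₙ, y₀)| < ε / 2` for `n < m`; along a convergent subsequence, `f (aₙ, bₙ)` and
`f (aₙ, bₙ₊₁)` have the same limit, although they differ by at least `ε / 2`. -/
theorem DenselySeqCompact.eventually_forall_abs_sub_le {X Y : Type*} [TopologicalSpace X]
    [TopologicalSpace Y] (hX : DenselySeqCompact X) (hY : DenselySeqCompact Y) {f : X × Y → ℝ}
    (hf : Continuous f) (y₀ : Y) {ε : ℝ} (hε : 0 < ε) :
    ∀ᶠ y in 𝓝 y₀, ∀ x, |f (x, y) - f (x, y₀)| ≤ ε := by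
  obtain ⟨D, hD, h⟩ := hX.prod hY
  by_contra hnot
  have hy₀ : Continuous fun q : X × Y => f (q.1, y₀) :=
    hf.comp (continuous_fst.prodMk continuous_const)
  obtain ⟨q, hq, hqq⟩ := exists_seq_of_forall_finset_exists
    (fun q : X × Y => q ∈ D ∧ ε < |f q - f (q.1, y₀)|)
    (fun q r : X × Y => |f (q.1, r.2) - f (q.1, y₀)| < ε / 2) (by
      intro s _
      have hslice : ∀ q : X × Y, Continuous fun y => |f (q.1, y) - f (q.1, y₀)| := fun q =>
        ((hf.comp (continuous_const.prodMk continuous_id)).sub continuous_const).abs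
      have hW : IsOpen (⋂ q ∈ s, {y | |f (q.1, y) - f (q.1, y₀)| < ε / 2}) :=
        isOpen_biInter_finset fun q _ => isOpen_lt (hslice q) continuous_const
      have hyW : y₀ ∈ ⋂ q ∈ s, {y | |f (q.1, y) - f (q.1, y₀)| < ε / 2} := by
        simp [hε]
      obtain ⟨y, ⟨x, hxy⟩, hy⟩ : ∃ y, (∃ x, ε < |f (x, y) - f (x, y₀)|) ∧
          y ∈ ⋂ q ∈ s, {y | |f (q.1, y) - f (q.1, y₀)| < ε / 2} := by
        by_contra! hcon
        refine hnot ?_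
        filter_upwards [hW.mem_nhds hyW] with y hy x
        by_contra! hlt
        exact hcon y ⟨x, hlt⟩ hy
      obtain ⟨r, ⟨hr1, hr2⟩, hrD⟩ := hD.inter_open_nonempty
        ({q | ε < |f q - f (q.1, y₀)|} ∩
          Prod.snd ⁻¹' ⋂ q ∈ s, {y | |f (q.1, y) - f (q.1, y₀)| < ε / 2})
        ((isOpen_lt continuous_const (hf.sub hy₀).abs).inter (hW.preimage continuous_snd))
        ⟨(x, y), hxy, hy⟩
      exact ⟨r, ⟨hrD, hr1⟩, by simpa using hr2⟩)
  obtain ⟨a, φ, hφ, ha⟩ := h q fun n => (hq n).1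
  have hlim1 : Tendsto (fun n => f (q (φ n))) atTop (𝓝 (f a)) := (hf.tendsto a).comp ha
  have hlim2 : Tendsto (fun n => f ((q (φ n)).1, (q (φ (n + 1))).2)) atTop (𝓝 (f a)) :=
    (hf.tendsto a).comp (((continuous_fst.tendsto a).comp ha).prodMk_nhds
      (((continuous_snd.tendsto a).comp ha).comp (tendsto_add_atTop_nat 1)))
  have hlim := (hlim1.sub hlim2).abs
  rw [sub_self, abs_zero] at hlim
  obtain ⟨n, hn⟩ := (hlim.eventually_lt_const (half_pos hε)).exists
  have h1 := (hq (φ n)).2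
  have h2 := hqq (φ n) (φ (n + 1)) (hφ n.lt_succ_self)
  have h3 := abs_sub_le (f (q (φ n))) (f ((q (φ n)).1, (q (φ (n + 1))).2)) (f ((q (φ n)).1, y₀))
  linarith

theorem FunctionallyCountable.prod {X Y : Type*} [TopologicalSpace X] [TopologicalSpace Y]
    (hX : FunctionallyCountable X) (hY : FunctionallyCountable Y) (hX' : DenselySeqCompact X)
    (hY' : DenselySeqCompact Y) : FunctionallyCountable (X × Y) := by
  intro f hf
  have hsec : ∀ y, Continuous fun x => f (x, y) := fun y =>
    hf.comp (continuous_id.prodMk continuous_const)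
  choose C hC using fun y => hX'.exists_forall_abs_le (hsec y)
  let F : Y → BoundedContinuousFunction X ℝ := fun y =>
    BoundedContinuousFunction.ofNormedAddCommGroup (fun x => f (x, y)) (hsec y) (C y) (hC y)
  have hF : Continuous F := by
    refine continuous_iff_continuousAt.2 fun y₀ => Metric.tendsto_nhds.2 fun ε hε => ?_
    filter_upwards [hX'.eventually_forall_abs_sub_le hY' hf y₀ (half_pos hε)] with y hy
    exact ((BoundedContinuousFunction.dist_le (half_pos hε).le).2 hy).trans_lt (half_lt_self hε)
  refine ((hY.countable_range hY' hF).biUnion fun G _ => hX G G.continuous).mono ?_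
  rintro _ ⟨⟨x, y⟩, rfl⟩
  exact mem_biUnion (mem_range_self y) ⟨x, rfl⟩

universe u v in
theorem denselySeqCompact_and_functionallyCountable_pi {ι : Type u} [Finite ι] :
    ∀ (X : ι → Type v) [∀ i, TopologicalSpace (X i)],
      (∀ i, DenselySeqCompact (X i) ∧ FunctionallyCountable (X i)) →
        DenselySeqCompact (∀ i, X i) ∧ FunctionallyCountable (∀ i, X i) := by
  induction ι using Finite.induction_empty_option with
  | of_equiv e ih =>
    intro X _ hX
    obtain ⟨h1, h2⟩ := ih (fun i => X (e i)) fun i => hX (e i)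
    let p := Homeomorph.piCongrLeft (Y := X) e
    exact ⟨h1.of_surjective p.continuous p.surjective, h2.of_surjective p.continuous p.surjective⟩
  | h_empty =>
    intro X _ _
    refine ⟨⟨univ, dense_univ, fun u _ => ⟨u 0, id, strictMono_id, ?_⟩⟩, fun f _ => ?_⟩
    · rw [show u ∘ id = fun _ => u 0 from funext fun n => Subsingleton.elim _ _]
      exact tendsto_const_nhds
    · exact countable_range f
  | h_option ih =>
    intro X _ hX
    obtain ⟨h1, h2⟩ := ih (fun i => X (some i)) fun i => hX (some i)
    let p : X none × (∀ i, X (some i)) → ∀ o, X o := fun q o => Option.rec q.1 q.2 o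
    have hp : Continuous p := by
      refine continuous_pi fun o => ?_
      cases o with
      | none => exact continuous_fst
      | some i => exact (continuous_apply i).comp continuous_snd
    have hs : Function.Surjective p := fun x =>
      ⟨(x none, fun i => x (some i)), funext fun o => by cases o <;> rfl⟩
    exact ⟨((hX none).1.prod h1).of_surjective hp hs,
      ((hX none).2.prod h2 (hX none).1 h1).of_surjective hp hs⟩

theorem mainTheorem2 {ι : Type*} [Finite ι] (X : ι → Type*) [∀ i, TopologicalSpace (X i)]
    (hX : ∀ i, Pseudocompact (X i) ∧ FunctionallyCountable (X i)) :
    Pseudocompact (∀ i, X i) ∧ FunctionallyCountable (∀ i, X i) := by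
  have := fun i => (hX i).1.1
  obtain ⟨h1, h2⟩ := denselySeqCompact_and_functionallyCountable_pi X fun i =>
    ⟨(hX i).1.denselySeqCompact (hX i).2, (hX i).2⟩
  exact ⟨⟨inferInstance, fun f hf => h1.exists_forall_abs_le hf⟩, h2⟩
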